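/- Let $d\ge 2$, $n\ge 1$, and let $\Omega\subset\mathbb{R}^d$ be an open polyhedral domain with a simplicial partition $\triangle$: a finite simplicial complex in $\mathbb R^d$ in which every face lies in a $d$-dimensional simplex, and whose union is $\overline\Omega$. "Simplex of $\triangle$" means (closed) $d$-dimensional simplex of $\triangle$. Let $S^0_n(\triangle)$ be the space of continuous functions on $\overline\Omega$ that coincide on each simplex of $\triangle$ with a polynomial of total degree at most $n$ (extended by zero outside $\overline\Omega$). Let $\mathcal W=H^1_0(\Omega)\cap S^0_n(\triangle)$ with $$\langle f,g\rangle_{\mathcal W}=\int_\Omega\nabla f\cdot\nabla g,\qquad \|f\|_{\mathcal W}=\Big(\int_\Omega|\nabla f|^2\Big)^{1/2},\qquad \|f\cdot\chi_T\|_{\mathcal W}:=\Big(\int_{\Omega\cap T}|\nabla f|^2\Big)^{1/2}$$ for a simplex $T$ of $\triangle$. For a set (cluster) $\omega$ of simplices of $\triangle$ put $\mathrm{star}^0(\omega)=\omega$ and let $\mathrm{star}^{k+1}(\omega)$ be the set of all simplices of $\triangle$ that intersect some simplex of $\mathrm{star}^k(\omega)$; we also write $\mathrm{star}^k(\omega)$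 for the union of these simplices, and $\mathrm{star}^k(T)=\mathrm{star}^k(\{T\})$. Suppose that $\mathcal W$ has a (finite) basis $\{\mathcal B_\xi\}_{\xi\in\mathcal M}$ that is $1$-local, i.e. for each $\xi\in\mathcal M$ there is a simplex $T_\xi$ of $\triangle$ with $\operatorname{supp}\mathcal B_\xi\subseteq \mathrm{star}^1(T_\xi)$, and that satisfies, with constants $C_1,C_2>0$, $$C_1\sum_{\xi\in\mathcal M}|c_\xi|^2\le\Big\|\sum_{\xi\in\mathcal M}c_\xi\mathcal B_\xi\Big\|_{\mathcal W}^2\le C_2\sum_{\xi\in\mathcal M}|c_\xi|^2$$ for all real coefficients $(c_\xi)_{\xi\in\mathcal M}$. Then there are constants $\sigma\in(0,1)$ and $C>0$, depending only on the ratio $C_2/C_1$ (in particular not on $d$, $n$, $\Omega$, $\triangle$, the basis, $\omega$, $T$, $k$ or $g$), such that the following holds. Let $\omega$ be a set of simplices of $\triangle$, let $T\in\omega$, and let $k\ge1$. If $g\in\mathcal W$ satisfies $$\langle g,w\rangle_{\mathcal W}=0\quad\text{for all } w\in\mathcal W\text{ with }\operatorname{supp}(w)\subseteq\mathrm{star}^k(\omega),$$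 then $$\|g\cdot\chi_T\|_{\mathcal W}\le C\,\sigma^k\,\|g\|_{\mathcal W}.$$ -/

import Mathlib

open MeasureTheory Filter Topology

noncomputable section

/-! ### The Sobolev space of functions vanishing on the boundary, and the energy inner product -/

/-- `φ` is a test function on `Ω`: smooth, with compact support contained in `Ω`. -/
structure IsTestFunction {d : ℕ} (Ω : Set (EuclideanSpace ℝ (Fin d)))
    (φ : EuclideanSpace ℝ (Fin d) → ℝ) : Prop where
  contDiff : ContDiff ℝ ((⊤ : ℕ∞) : WithTop ℕ∞) φ
  hasCompactSupport : HasCompactSupport φ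
  tsupport_subset : tsupport φ ⊆ Ω

/-- `u` and `G` are square integrable on `Ω`, and `G` is the weak gradient of `u` on `Ω`. -/
structure HasWeakGradient {d : ℕ} (Ω : Set (EuclideanSpace ℝ (Fin d)))
    (u : EuclideanSpace ℝ (Fin d) → ℝ)
    (G : EuclideanSpace ℝ (Fin d) → EuclideanSpace ℝ (Fin d)) : Prop where
  memLp : MemLp u 2 (volume.restrict Ω)
  memLp_grad : MemLp G 2 (volume.restrict Ω)
  integral_eq : ∀ φ : EuclideanSpace ℝ (Fin d) → ℝ, IsTestFunction Ω φ →
    ∫ x in Ω, u x • gradient φ x = - ∫ x in Ω, φ x • G x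

open Classical in
/-- The weak gradient of `u` on `Ω` (determined almost everywhere on `Ω` if `Ω` is open and
`u ∈ H¹(Ω)`, and zero if `u ∉ H¹(Ω)`). -/
def weakGradient {d : ℕ} (Ω : Set (EuclideanSpace ℝ (Fin d)))
    (u : EuclideanSpace ℝ (Fin d) → ℝ) : EuclideanSpace ℝ (Fin d) → EuclideanSpace ℝ (Fin d) :=
  if h : ∃ G, HasWeakGradient Ω u G then h.choose else 0

/-- `u ∈ H¹₀(Ω)`: `u` lies in `H¹(Ω)` and is a limit of test functions on `Ω` in the
`H¹(Ω)`-norm. -/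
def MemH10 {d : ℕ} (Ω : Set (EuclideanSpace ℝ (Fin d)))
    (u : EuclideanSpace ℝ (Fin d) → ℝ) : Prop :=
  ∃ G, HasWeakGradient Ω u G ∧
    ∃ φ : ℕ → EuclideanSpace ℝ (Fin d) → ℝ, (∀ j, IsTestFunction Ω (φ j)) ∧
      Tendsto (fun j => eLpNorm (fun x => φ j x - u x) 2 (volume.restrict Ω)) atTop (𝓝 0) ∧
      Tendsto (fun j => eLpNorm (fun x => gradient (φ j) x - G x) 2 (volume.restrict Ω))
        atTop (𝓝 0)

/-- The energy inner product `⟨∇f, ∇g⟩` of `L²(Ω)`. -/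
def energyInner {d : ℕ} (Ω : Set (EuclideanSpace ℝ (Fin d)))
    (f g : EuclideanSpace ℝ (Fin d) → ℝ) : ℝ :=
  ∫ x in Ω, inner ℝ (weakGradient Ω f x) (weakGradient Ω g x)

/-- The energy norm `‖∇f‖` of `L²(Ω)`. -/
def energyNorm {d : ℕ} (Ω : Set (EuclideanSpace ℝ (Fin d)))
    (f : EuclideanSpace ℝ (Fin d) → ℝ) : ℝ :=
  Real.sqrt (energyInner Ω f f)

/-- The energy norm of `f · χ_A`, that is, the `L²(Ω)`-norm of `χ_A ∇f`. -/
def energyNormOn {d : ℕ} (Ω A : Set (EuclideanSpace ℝ (Fin d)))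
    (f : EuclideanSpace ℝ (Fin d) → ℝ) : ℝ :=
  Real.sqrt (∫ x in Ω, ‖A.indicator (weakGradient Ω f) x‖ ^ 2)

/-! ### Simplicial partitions and stars -/

/-- `K` is a (finite, conforming) simplicial partition of the open set `Ω ⊆ ℝᵈ` into
`d`-dimensional simplices and their faces. -/
structure IsSimplicialPartition {d : ℕ}
    (K : Geometry.SimplicialComplex ℝ (EuclideanSpace ℝ (Fin d)))
    (Ω : Set (EuclideanSpace ℝ (Fin d))) : Prop where
  isOpen : IsOpen Ω
  finite : K.faces.Finite
  pure : ∀ s ∈ K.faces, ∃ t ∈ K.faces, s ⊆ t ∧ t.card = d + 1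
  space_eq : K.space = closure Ω

/-- The `d`-dimensional simplices of the partition, each given by its vertices. -/
def simplices {d : ℕ} (K : Geometry.SimplicialComplex ℝ (EuclideanSpace ℝ (Fin d))) :
    Set (Finset (EuclideanSpace ℝ (Fin d))) :=
  {T | T ∈ K.faces ∧ T.card = d + 1}

/-- The simplex with vertex set `T`, as a closed set of points. -/
def simplexSet {d : ℕ} (T : Finset (EuclideanSpace ℝ (Fin d))) :
    Set (EuclideanSpace ℝ (Fin d)) :=
  convexHull ℝ (T : Set (EuclideanSpace ℝ (Fin d)))

/-- The simplices of `star^k(ω)` for a cluster `ω` of simplices: `star^0(ω) = ω`, and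
`star^(k+1)(ω)` consists of all simplices which touch a simplex of `star^k(ω)`. -/
def starCluster {d : ℕ} (K : Geometry.SimplicialComplex ℝ (EuclideanSpace ℝ (Fin d)))
    (ω : Set (Finset (EuclideanSpace ℝ (Fin d)))) :
    ℕ → Set (Finset (EuclideanSpace ℝ (Fin d)))
  | 0 => ω
  | k + 1 => {T | T ∈ simplices K ∧
      ∃ t ∈ starCluster K ω k, (simplexSet T ∩ simplexSet t).Nonempty}

/-- `star^k(ω)` as a set of points: the union of its simplices. -/
def starSet {d : ℕ} (K : Geometry.SimplicialComplex ℝ (EuclideanSpace ℝ (Fin d)))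
    (ω : Set (Finset (EuclideanSpace ℝ (Fin d)))) (k : ℕ) : Set (EuclideanSpace ℝ (Fin d)) :=
  ⋃ T ∈ starCluster K ω k, simplexSet T

/-! ### Splines -/

/-- The space of continuous splines of degree `n`: functions which are continuous on the union of
the simplices and agree on each simplex with a polynomial of total degree at most `n`. They are
extended by zero to all of `ℝᵈ`. -/
def splineSpace {d : ℕ} (K : Geometry.SimplicialComplex ℝ (EuclideanSpace ℝ (Fin d))) (n : ℕ) :
    Submodule ℝ (EuclideanSpace ℝ (Fin d) → ℝ) where
  carrier := {u | ContinuousOn u K.space ∧ (∀ x, x ∉ K.space → u x = 0) ∧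
    ∀ T ∈ simplices K, ∃ p : MvPolynomial (Fin d) ℝ, p.totalDegree ≤ n ∧
      ∀ x ∈ simplexSet T, u x = MvPolynomial.eval (fun i => x i) p}
  add_mem' := by
    rintro u v ⟨hu1, hu2, hu3⟩ ⟨hv1, hv2, hv3⟩
    refine ⟨hu1.add hv1, fun x hx => by simp [hu2 x hx, hv2 x hx], fun T hT => ?_⟩
    obtain ⟨p, hp, hp'⟩ := hu3 T hT
    obtain ⟨q, hq, hq'⟩ := hv3 T hT
    exact ⟨p + q, (MvPolynomial.totalDegree_add p q).trans (max_le hp hq),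
      fun x hx => by simp [hp' x hx, hq' x hx]⟩
  zero_mem' := ⟨continuousOn_const, fun _ _ => rfl, fun _ _ => ⟨0, by simp, by simp⟩⟩
  smul_mem' := by
    rintro c u ⟨hu1, hu2, hu3⟩
    refine ⟨hu1.const_smul c, fun x hx => by simp [hu2 x hx], fun T hT => ?_⟩
    obtain ⟨p, hp, hp'⟩ := hu3 T hT
    exact ⟨c • p, (MvPolynomial.totalDegree_smul_le c p).trans hp,
      fun x hx => by simp [hp' x hx, MvPolynomial.smul_eval]⟩

lemma IsTestFunction.continuous_gradient {d : ℕ} {Ω : Set (EuclideanSpace ℝ (Fin d))}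
    {φ : EuclideanSpace ℝ (Fin d) → ℝ} (h : IsTestFunction Ω φ) : Continuous (gradient φ) :=
  (InnerProductSpace.toDual ℝ (EuclideanSpace ℝ (Fin d))).symm.continuous.comp
    (h.contDiff.continuous_fderiv (by simp))

lemma IsTestFunction.hasCompactSupport_gradient {d : ℕ} {Ω : Set (EuclideanSpace ℝ (Fin d))}
    {φ : EuclideanSpace ℝ (Fin d) → ℝ} (h : IsTestFunction Ω φ) :
    HasCompactSupport (gradient φ) :=
  (h.hasCompactSupport.fderiv (𝕜 := ℝ)).comp_left
    (g := (InnerProductSpace.toDual ℝ (EuclideanSpace ℝ (Fin d))).symm) (map_zero _)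

lemma IsTestFunction.memLp_two {d : ℕ} {Ω : Set (EuclideanSpace ℝ (Fin d))}
    {φ : EuclideanSpace ℝ (Fin d) → ℝ} (h : IsTestFunction Ω φ) :
    MemLp φ 2 (volume.restrict Ω) :=
  h.contDiff.continuous.memLp_of_hasCompactSupport h.hasCompactSupport

lemma IsTestFunction.memLp_two_gradient {d : ℕ} {Ω : Set (EuclideanSpace ℝ (Fin d))}
    {φ : EuclideanSpace ℝ (Fin d) → ℝ} (h : IsTestFunction Ω φ) :
    MemLp (gradient φ) 2 (volume.restrict Ω) :=
  h.continuous_gradient.memLp_of_hasCompactSupport h.hasCompactSupport_gradient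

lemma gradient_add_of_test {d : ℕ} {Ω : Set (EuclideanSpace ℝ (Fin d))}
    {φ ψ : EuclideanSpace ℝ (Fin d) → ℝ} (h : IsTestFunction Ω φ) (h' : IsTestFunction Ω ψ)
    (x : EuclideanSpace ℝ (Fin d)) :
    gradient (φ + ψ) x = gradient φ x + gradient ψ x := by
  unfold gradient
  rw [fderiv_add ((h.contDiff.differentiable (by simp)) x)
    ((h'.contDiff.differentiable (by simp)) x), map_add]

lemma gradient_smul_of_test {d : ℕ} {Ω : Set (EuclideanSpace ℝ (Fin d))}
    {φ : EuclideanSpace ℝ (Fin d) → ℝ} (h : IsTestFunction Ω φ) (c : ℝ)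
    (x : EuclideanSpace ℝ (Fin d)) :
    gradient (c • φ) x = c • gradient φ x := by
  unfold gradient
  rw [fderiv_const_smul ((h.contDiff.differentiable (by simp)) x)]
  simp

lemma IsTestFunction.add {d : ℕ} {Ω : Set (EuclideanSpace ℝ (Fin d))}
    {φ ψ : EuclideanSpace ℝ (Fin d) → ℝ} (h : IsTestFunction Ω φ) (h' : IsTestFunction Ω ψ) :
    IsTestFunction Ω (φ + ψ) where
  contDiff := h.contDiff.add h'.contDiff
  hasCompactSupport := h.hasCompactSupport.add h'.hasCompactSupport
  tsupport_subset := (tsupport_add φ ψ).trans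
    (Set.union_subset h.tsupport_subset h'.tsupport_subset)

lemma IsTestFunction.const_smul {d : ℕ} {Ω : Set (EuclideanSpace ℝ (Fin d))}
    {φ : EuclideanSpace ℝ (Fin d) → ℝ} (h : IsTestFunction Ω φ) (c : ℝ) :
    IsTestFunction Ω (c • φ) where
  contDiff := h.contDiff.const_smul c
  hasCompactSupport := h.hasCompactSupport.smul_left (f := fun _ => c)
  tsupport_subset := (tsupport_smul_subset_right (fun _ => c) φ).trans h.tsupport_subset

lemma HasWeakGradient.add {d : ℕ} {Ω : Set (EuclideanSpace ℝ (Fin d))}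
    {u v : EuclideanSpace ℝ (Fin d) → ℝ}
    {G H : EuclideanSpace ℝ (Fin d) → EuclideanSpace ℝ (Fin d)}
    (hu : HasWeakGradient Ω u G) (hv : HasWeakGradient Ω v H) :
    HasWeakGradient Ω (u + v) (G + H) where
  memLp := hu.memLp.add hv.memLp
  memLp_grad := hu.memLp_grad.add hv.memLp_grad
  integral_eq φ hφ := by
    have e1 := hu.integral_eq φ hφ
    have e2 := hv.integral_eq φ hφ
    have i1 : Integrable (fun x => u x • gradient φ x) (volume.restrict Ω) :=
      memLp_one_iff_integrable.1 (hφ.memLp_two_gradient.smul hu.memLp)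
    have i2 : Integrable (fun x => v x • gradient φ x) (volume.restrict Ω) :=
      memLp_one_iff_integrable.1 (hφ.memLp_two_gradient.smul hv.memLp)
    have i3 : Integrable (fun x => φ x • G x) (volume.restrict Ω) :=
      memLp_one_iff_integrable.1 (hu.memLp_grad.smul hφ.memLp_two)
    have i4 : Integrable (fun x => φ x • H x) (volume.restrict Ω) :=
      memLp_one_iff_integrable.1 (hv.memLp_grad.smul hφ.memLp_two)
    simp only [Pi.add_apply, add_smul, smul_add]
    rw [integral_add i1 i2, integral_add i3 i4, e1, e2, neg_add]

lemma HasWeakGradient.const_smul {d : ℕ} {Ω : Set (EuclideanSpace ℝ (Fin d))}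
    {u : EuclideanSpace ℝ (Fin d) → ℝ}
    {G : EuclideanSpace ℝ (Fin d) → EuclideanSpace ℝ (Fin d)}
    (hu : HasWeakGradient Ω u G) (c : ℝ) : HasWeakGradient Ω (c • u) (c • G) where
  memLp := hu.memLp.const_smul c
  memLp_grad := hu.memLp_grad.const_smul c
  integral_eq φ hφ := by
    have e1 := hu.integral_eq φ hφ
    simp only [Pi.smul_apply, smul_eq_mul, mul_smul, smul_comm _ c]
    rw [integral_smul, integral_smul, e1, smul_neg]

/-- `H¹₀(Ω)` as a linear space of functions. -/
def sobolevH10 {d : ℕ} (Ω : Set (EuclideanSpace ℝ (Fin d))) :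
    Submodule ℝ (EuclideanSpace ℝ (Fin d) → ℝ) where
  carrier := {u | MemH10 Ω u}
  add_mem' := by
    rintro u v ⟨G, hG, φ, hφ, hφ1, hφ2⟩ ⟨H, hH, ψ, hψ, hψ1, hψ2⟩
    refine ⟨G + H, hG.add hH, fun j => φ j + ψ j, fun j => (hφ j).add (hψ j), ?_, ?_⟩
    · refine tendsto_of_tendsto_of_tendsto_of_le_of_le tendsto_const_nhds
        (by simpa using hφ1.add hψ1) (fun _ => zero_le) (fun j => ?_)
      have e : (fun x => (φ j + ψ j) x - (u + v) x)
          = (fun x => φ j x - u x) + fun x => ψ j x - v x := by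
        ext x; simp only [Pi.add_apply]; ring
      rw [e]
      exact eLpNorm_add_le ((hφ j).memLp_two.sub hG.memLp).1
        ((hψ j).memLp_two.sub hH.memLp).1 (by norm_num)
    · refine tendsto_of_tendsto_of_tendsto_of_le_of_le tendsto_const_nhds
        (by simpa using hφ2.add hψ2) (fun _ => zero_le) (fun j => ?_)
      have e : (fun x => gradient (φ j + ψ j) x - (G + H) x)
          = (fun x => gradient (φ j) x - G x) + fun x => gradient (ψ j) x - H x := by
        ext1 x; simp only [Pi.add_apply, gradient_add_of_test (hφ j) (hψ j)]; abel
      rw [e]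
      exact eLpNorm_add_le ((hφ j).memLp_two_gradient.sub hG.memLp_grad).1
        ((hψ j).memLp_two_gradient.sub hH.memLp_grad).1 (by norm_num)
  zero_mem' := by
    have e : gradient (0 : EuclideanSpace ℝ (Fin d) → ℝ) = 0 := by
      ext1 x; simp [gradient]
    refine ⟨0, ⟨MemLp.zero, MemLp.zero, by simp⟩, fun _ => 0, fun _ => ?_, ?_, ?_⟩
    · exact ⟨contDiff_const, HasCompactSupport.zero, by simp [tsupport]⟩
    · simp
    · simp [e]
  smul_mem' := by
    rintro c u ⟨G, hG, φ, hφ, hφ1, hφ2⟩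
    refine ⟨c • G, hG.const_smul c, fun j => c • φ j, fun j => (hφ j).const_smul c, ?_, ?_⟩
    · have e : ∀ j, (fun x => (c • φ j) x - (c • u) x) = c • fun x => φ j x - u x := by
        intro j; ext x; simp only [Pi.smul_apply, smul_sub]
      simp only [e, eLpNorm_const_smul]
      simpa using ENNReal.Tendsto.const_mul hφ1 (Or.inr (by simp))
    · have e : ∀ j, (fun x => gradient (c • φ j) x - (c • G) x)
          = c • fun x => gradient (φ j) x - G x := by
        intro j; ext1 x
        simp only [Pi.smul_apply, smul_sub, gradient_smul_of_test (hφ j)]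
      simp only [e, eLpNorm_const_smul]
      simpa using ENNReal.Tendsto.const_mul hφ2 (Or.inr (by simp))

/-- The space `W = H¹₀(Ω) ∩ S⁰ₙ(△)`. -/
def splineH10 {d : ℕ} (K : Geometry.SimplicialComplex ℝ (EuclideanSpace ℝ (Fin d)))
    (Ω : Set (EuclideanSpace ℝ (Fin d))) (n : ℕ) :
    Submodule ℝ (EuclideanSpace ℝ (Fin d) → ℝ) :=
  sobolevH10 Ω ⊓ splineSpace K n

/-- The functions `B ξ` form a `1`-local family: each is supported in `star^1(T_ξ)` for some
simplex `T_ξ` of the partition. -/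
def IsOneLocal {d : ℕ} (K : Geometry.SimplicialComplex ℝ (EuclideanSpace ℝ (Fin d)))
    {ι : Type*} (B : ι → EuclideanSpace ℝ (Fin d) → ℝ) : Prop :=
  ∀ ξ, ∃ T ∈ simplices K, tsupport (B ξ) ⊆ starSet K {T} 1

/-- The Riesz bounds with constants `C₁`, `C₂` for the family `B` in the energy norm. -/
def RieszBounds {d : ℕ} (Ω : Set (EuclideanSpace ℝ (Fin d))) {ι : Type*} [Fintype ι]
    (B : ι → EuclideanSpace ℝ (Fin d) → ℝ) (C₁ C₂ : ℝ) : Prop :=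
  ∀ c : ι → ℝ, C₁ * ∑ ξ, |c ξ| ^ 2 ≤ energyNorm Ω (∑ ξ, c ξ • B ξ) ^ 2 ∧
    energyNorm Ω (∑ ξ, c ξ • B ξ) ^ 2 ≤ C₂ * ∑ ξ, |c ξ| ^ 2

end

/-! The decay is that of the coefficients in `g = ∑ c ξ • B ξ`. Let `M j` collect the `ξ` with `T_ξ`
in `star^j(ω)`, and let `a j` be the sum of `c ξ ^ 2` over `M j`. Locality makes `g` orthogonal to
`B ξ` for `ξ ∈ M j` when `j + 1 ≤ k`, and makes `B ξ`, `B η` orthogonal when `ξ ∈ M j`, `η ∉ M (j +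
2)`.

Write `S` for partial sums of `g` and take `M₀ ⊆ M₁ ⊆ M₂` two layers apart. Testing `g` against `S
M₁` leaves `‖S M₁‖² = -⟨S (M₂ \ M₁), S (M₁ \ M₀)⟩`. By the Riesz bounds the left side is at least
`C₁ a₀` and the right side at most `C₂ (a₂ - a₀) / 2`, so `a₀ ≤ C₂ / (2 C₁ + C₂) * a₂`
(`sum_sq_coeff_le_of_orthogonal`). Only `C₂ / C₁` enters this factor. Iterating from `a 1`, which
controls `g` on `T`, gives the theorem (`energyNormOn_sq_le`).

The analytic input is that `weakGradient`, a choice, becomes a linear map `gradLp` into `L²`, and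
that gradients of functions supported in stars vanish a.e. on simplices outside them. -/

/-! ### Weak gradients as square integrable vector fields -/

/-- A square integrable vector field on an open set whose integrals against all test functions
supported in a smaller open set vanish is zero almost everywhere on the smaller set. -/
lemma ae_eq_zero_of_integral_testFunction {d : ℕ} {Ω U : Set (EuclideanSpace ℝ (Fin d))}
    (hU : IsOpen U) (hUΩ : U ⊆ Ω)
    {G : EuclideanSpace ℝ (Fin d) → EuclideanSpace ℝ (Fin d)}
    (hG : MemLp G 2 (volume.restrict Ω))
    (h : ∀ φ, IsTestFunction U φ → ∫ x in Ω, φ x • G x = 0) :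
    ∀ᵐ x, x ∈ U → G x = 0 := by
  have hloc : LocallyIntegrableOn G Ω volume :=
    locallyIntegrableOn_of_locallyIntegrable_restrict (hG.locallyIntegrable (by norm_num))
  refine hU.ae_eq_zero_of_integral_contDiff_smul_eq_zero (hloc.mono_set hUΩ)
    fun φ h1 h2 h3 => ?_
  rw [← h φ ⟨h1, h2, h3⟩, setIntegral_eq_integral_of_forall_compl_eq_zero]
  intro x hx
  rw [image_eq_zero_of_notMem_tsupport fun hx' => hx (hUΩ (h3 hx')), zero_smul]

lemma IsTestFunction.mono {d : ℕ} {U Ω : Set (EuclideanSpace ℝ (Fin d))} (hU : U ⊆ Ω)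
    {φ : EuclideanSpace ℝ (Fin d) → ℝ} (h : IsTestFunction U φ) : IsTestFunction Ω φ :=
  ⟨h.contDiff, h.hasCompactSupport, h.tsupport_subset.trans hU⟩

/-- The weak gradient is unique up to null sets. -/
lemma HasWeakGradient.ae_eq {d : ℕ} {Ω : Set (EuclideanSpace ℝ (Fin d))} (hΩ : IsOpen Ω)
    {u : EuclideanSpace ℝ (Fin d) → ℝ}
    {G H : EuclideanSpace ℝ (Fin d) → EuclideanSpace ℝ (Fin d)}
    (hG : HasWeakGradient Ω u G) (hH : HasWeakGradient Ω u H) :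
    G =ᵐ[volume.restrict Ω] H := by
  have key := ae_eq_zero_of_integral_testFunction hΩ subset_rfl
    (hG.memLp_grad.sub hH.memLp_grad) fun φ hφ => by
      have i1 : Integrable (fun x => φ x • G x) (volume.restrict Ω) :=
        memLp_one_iff_integrable.1 (hG.memLp_grad.smul hφ.memLp_two)
      have i2 : Integrable (fun x => φ x • H x) (volume.restrict Ω) :=
        memLp_one_iff_integrable.1 (hH.memLp_grad.smul hφ.memLp_two)
      simp only [Pi.sub_apply, smul_sub]
      rw [integral_sub i1 i2, sub_eq_zero, ← neg_inj, ← hG.integral_eq φ hφ,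
        hH.integral_eq φ hφ]
  filter_upwards [(ae_restrict_iff' hΩ.measurableSet).2 key] with x hx
  exact sub_eq_zero.1 hx

/-- The weak gradient of `u` vanishes almost everywhere outside the support of `u`. -/
lemma HasWeakGradient.ae_eq_zero_of_notMem_tsupport {d : ℕ}
    {Ω : Set (EuclideanSpace ℝ (Fin d))} (hΩ : IsOpen Ω) {u : EuclideanSpace ℝ (Fin d) → ℝ}
    {G : EuclideanSpace ℝ (Fin d) → EuclideanSpace ℝ (Fin d)} (hG : HasWeakGradient Ω u G) :
    ∀ᵐ x ∂(volume.restrict Ω), x ∉ tsupport u → G x = 0 := by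
  have key := ae_eq_zero_of_integral_testFunction
    (hΩ.sdiff (isClosed_tsupport u)) Set.sdiff_subset hG.memLp_grad fun φ hφ => by
      rw [← neg_eq_zero, ← hG.integral_eq φ (hφ.mono Set.sdiff_subset)]
      refine integral_eq_zero_of_ae (ae_of_all _ fun x => ?_)
      -- The integrand `u ∇φ` vanishes pointwise: `∇φ = 0` on the support of `u`, and `u = 0` off
      -- it.
      by_cases hx : x ∈ tsupport u
      · have h0 : x ∉ tsupport φ := fun h => (hφ.tsupport_subset h).2 hx
        have h1 : fderiv ℝ φ x = 0 :=
          image_eq_zero_of_notMem_tsupport fun h => h0 (tsupport_fderiv_subset ℝ h)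
        simp [gradient, h1]
      · simp [image_eq_zero_of_notMem_tsupport hx]
  rw [ae_restrict_iff' hΩ.measurableSet]
  filter_upwards [key] with x hx h1 h2
  exact hx ⟨h1, h2⟩

lemma MemH10.hasWeakGradient {d : ℕ} {Ω : Set (EuclideanSpace ℝ (Fin d))}
    {u : EuclideanSpace ℝ (Fin d) → ℝ} (hu : MemH10 Ω u) :
    HasWeakGradient Ω u (weakGradient Ω u) := by
  obtain ⟨G, hG, -⟩ := hu
  have h : ∃ G, HasWeakGradient Ω u G := ⟨G, hG⟩
  rw [weakGradient, dif_pos h]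
  exact h.choose_spec

/-- The weak gradient as a linear map from `H¹₀(Ω)` to `L²(Ω)`. -/
noncomputable def gradLp {d : ℕ} {Ω : Set (EuclideanSpace ℝ (Fin d))} (hΩ : IsOpen Ω) :
    sobolevH10 Ω →ₗ[ℝ] Lp (EuclideanSpace ℝ (Fin d)) 2 (volume.restrict Ω) where
  toFun u := (MemH10.hasWeakGradient u.2).memLp_grad.toLp _
  -- The chosen representatives need not add up pointwise; uniqueness a.e. gives additivity in `L²`.
  map_add' u v := by
    rw [← MemLp.toLp_add, MemLp.toLp_eq_toLp_iff]
    exact (MemH10.hasWeakGradient (u + v).2).ae_eq hΩ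
      ((MemH10.hasWeakGradient u.2).add (MemH10.hasWeakGradient v.2))
  map_smul' c u := by
    rw [RingHom.id_apply, ← MemLp.toLp_const_smul, MemLp.toLp_eq_toLp_iff]
    exact (MemH10.hasWeakGradient (c • u).2).ae_eq hΩ
      ((MemH10.hasWeakGradient u.2).const_smul c)

lemma coeFn_gradLp {d : ℕ} {Ω : Set (EuclideanSpace ℝ (Fin d))} (hΩ : IsOpen Ω)
    (u : sobolevH10 Ω) :
    gradLp hΩ u =ᵐ[volume.restrict Ω] weakGradient Ω (u : EuclideanSpace ℝ (Fin d) → ℝ) :=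
  MemLp.coeFn_toLp (MemH10.hasWeakGradient u.2).memLp_grad

lemma inner_gradLp {d : ℕ} {Ω : Set (EuclideanSpace ℝ (Fin d))} (hΩ : IsOpen Ω)
    (u v : sobolevH10 Ω) :
    inner ℝ (gradLp hΩ u) (gradLp hΩ v) = energyInner Ω u v := by
  rw [L2.inner_def, energyInner]
  refine integral_congr_ae ?_
  filter_upwards [coeFn_gradLp hΩ u, coeFn_gradLp hΩ v] with x h1 h2
  rw [h1, h2]

lemma norm_gradLp {d : ℕ} {Ω : Set (EuclideanSpace ℝ (Fin d))} (hΩ : IsOpen Ω)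
    (u : sobolevH10 Ω) : ‖gradLp hΩ u‖ = energyNorm Ω u := by
  rw [energyNorm, ← inner_gradLp hΩ, real_inner_self_eq_norm_sq, Real.sqrt_sq (norm_nonneg _)]

lemma gradLp_ae_eq_zero_of_notMem_tsupport {d : ℕ} {Ω : Set (EuclideanSpace ℝ (Fin d))}
    (hΩ : IsOpen Ω) (u : sobolevH10 Ω) :
    ∀ᵐ x ∂(volume.restrict Ω),
      x ∉ tsupport (u : EuclideanSpace ℝ (Fin d) → ℝ) → gradLp hΩ u x = 0 := by
  filter_upwards [(MemH10.hasWeakGradient u.2).ae_eq_zero_of_notMem_tsupport hΩ,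
    coeFn_gradLp hΩ u] with x h1 h2 h3
  rw [h2, h1 h3]

lemma measurableSet_simplexSet {d : ℕ} (T : Finset (EuclideanSpace ℝ (Fin d))) :
    MeasurableSet (simplexSet T) :=
  (T.finite_toSet.isCompact_convexHull (𝕜 := ℝ)).isClosed.measurableSet

/-- If the gradients of `u` and `v` agree almost everywhere on `A`, the energy norm of `u` on `A`
is bounded by that of `v` on the whole domain. -/
lemma energyNormOn_le_norm {d : ℕ} {Ω A : Set (EuclideanSpace ℝ (Fin d))} (hΩ : IsOpen Ω)
    (u v : sobolevH10 Ω)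
    (h : ∀ᵐ x ∂(volume.restrict Ω), x ∈ A → gradLp hΩ u x = gradLp hΩ v x) :
    energyNormOn Ω A u ≤ ‖gradLp hΩ v‖ := by
  rw [energyNormOn, ← Real.sqrt_sq (norm_nonneg (gradLp hΩ v))]
  refine Real.sqrt_le_sqrt ?_
  rw [← real_inner_self_eq_norm_sq, L2.inner_def]
  refine integral_mono_of_nonneg (ae_of_all _ fun x => sq_nonneg _)
    (L2.integrable_inner _ _) ?_
  filter_upwards [h, coeFn_gradLp hΩ u] with x h1 h2
  simp only [real_inner_self_eq_norm_sq]
  by_cases hx : x ∈ A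
  · rw [Set.indicator_of_mem hx, ← h2, h1 hx]
  · rw [Set.indicator_of_notMem hx, norm_zero, zero_pow two_ne_zero]
    exact sq_nonneg ‖gradLp hΩ v x‖

/-! ### Simplices and stars -/

/-- At most `d` points span a proper affine subspace, which is Lebesgue null. -/
lemma volume_convexHull_eq_zero_of_card_le {d : ℕ} {S : Finset (EuclideanSpace ℝ (Fin d))}
    (hS : AffineIndependent ℝ ((↑) : S → EuclideanSpace ℝ (Fin d))) (hcard : S.card ≤ d) :
    volume (convexHull ℝ (S : Set (EuclideanSpace ℝ (Fin d)))) = 0 := by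
  refine measure_mono_null (convexHull_subset_affineSpan _)
    (Measure.addHaar_affineSubspace _ _ fun h => ?_)
  have := hS.affineSpan_eq_top_iff_card_eq_finrank_add_one.1 (by simpa using h)
  simp at this
  omega

/-- Distinct simplices of a simplicial complex overlap in a null set. -/
lemma volume_simplexSet_inter_eq_zero {d : ℕ}
    {K : Geometry.SimplicialComplex ℝ (EuclideanSpace ℝ (Fin d))}
    {S T : Finset (EuclideanSpace ℝ (Fin d))} (hS : S ∈ simplices K) (hT : T ∈ simplices K)
    (hST : S ≠ T) : volume (simplexSet S ∩ simplexSet T) = 0 := by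
  classical
  -- The overlap is the hull of the common vertices, of which there are at most `d`.
  rw [simplexSet, simplexSet, Geometry.SimplicialComplex.convexHull_inter_convexHull hS.1 hT.1,
    ← Finset.coe_inter]
  refine volume_convexHull_eq_zero_of_card_le ?_ ?_
  · exact AffineIndependent.mono (t := (S : Set (EuclideanSpace ℝ (Fin d)))) (K.indep hS.1)
      (Finset.coe_subset.2 Finset.inter_subset_left)
  · have h : (S ∩ T).card < S.card := by
      refine Finset.card_lt_card (Finset.ssubset_iff_subset_ne.2
        ⟨Finset.inter_subset_left, fun h => hST ?_⟩)
      exact Finset.eq_of_subset_of_card_le (Finset.inter_eq_left.1 h) (by rw [hS.2, hT.2])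
    have := hS.2
    omega

lemma simplexSet_nonempty {d : ℕ}
    {K : Geometry.SimplicialComplex ℝ (EuclideanSpace ℝ (Fin d))}
    {T : Finset (EuclideanSpace ℝ (Fin d))} (hT : T ∈ simplices K) :
    (simplexSet T).Nonempty :=
  convexHull_nonempty_iff.2 (Geometry.SimplicialComplex.nonempty_of_mem_faces hT.1)

lemma starCluster_subset_simplices {d : ℕ}
    {K : Geometry.SimplicialComplex ℝ (EuclideanSpace ℝ (Fin d))}
    {ω : Set (Finset (EuclideanSpace ℝ (Fin d)))} (hω : ω ⊆ simplices K) :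
    ∀ k, starCluster K ω k ⊆ simplices K
  | 0 => hω
  | _ + 1 => fun _ hT => hT.1

/-- Every simplex is nonempty, hence touches itself. -/
lemma starCluster_mono {d : ℕ}
    {K : Geometry.SimplicialComplex ℝ (EuclideanSpace ℝ (Fin d))}
    {ω : Set (Finset (EuclideanSpace ℝ (Fin d)))} (hω : ω ⊆ simplices K) :
    Monotone (starCluster K ω) := by
  refine monotone_nat_of_le_succ fun k T hT => ?_
  have h := starCluster_subset_simplices hω k hT
  exact ⟨h, T, hT, by simpa using simplexSet_nonempty h⟩

lemma mem_starCluster_singleton_one {d : ℕ}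
    {K : Geometry.SimplicialComplex ℝ (EuclideanSpace ℝ (Fin d))}
    {S T : Finset (EuclideanSpace ℝ (Fin d))} :
    S ∈ starCluster K {T} 1 ↔ S ∈ simplices K ∧ (simplexSet S ∩ simplexSet T).Nonempty := by
  simp [starCluster]

/-- The gradient of a function supported in a star vanishes on every simplex outside it. -/
lemma gradLp_ae_eq_zero_on_simplexSet {d : ℕ} {Ω : Set (EuclideanSpace ℝ (Fin d))}
    {K : Geometry.SimplicialComplex ℝ (EuclideanSpace ℝ (Fin d))}
    (hK : IsSimplicialPartition K Ω) {ω : Set (Finset (EuclideanSpace ℝ (Fin d)))} {k : ℕ}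
    (hω : ω ⊆ simplices K) {u : sobolevH10 Ω}
    (hu : tsupport (u : EuclideanSpace ℝ (Fin d) → ℝ) ⊆ starSet K ω k)
    {T : Finset (EuclideanSpace ℝ (Fin d))} (hT : T ∈ simplices K)
    (hTω : T ∉ starCluster K ω k) :
    ∀ᵐ x ∂(volume.restrict Ω), x ∈ simplexSet T → gradLp hK.isOpen u x = 0 := by
  have hfin : (starCluster K ω k).Finite :=
    hK.finite.subset fun S hS => (starCluster_subset_simplices hω k hS).1
  -- `T` may touch the star, but only in a finite union of null overlaps.
  have hnull : ∀ᵐ x ∂(volume.restrict Ω), ∀ S ∈ starCluster K ω k,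
      x ∉ simplexSet S ∩ simplexSet T := by
    refine (ae_ball_iff hfin.countable).2 fun S hS => ae_restrict_of_ae ?_
    exact measure_eq_zero_iff_ae_notMem.1 (volume_simplexSet_inter_eq_zero
      (starCluster_subset_simplices hω k hS) hT (by rintro rfl; exact hTω hS))
  filter_upwards [hnull, gradLp_ae_eq_zero_of_notMem_tsupport hK.isOpen u] with x h1 h2 hx
  refine h2 fun hxu => ?_
  obtain ⟨S, hS, hxS⟩ := Set.mem_iUnion₂.1 (hu hxu)
  exact h1 S hS ⟨hxS, hx⟩

/-- Functions supported in stars without a common simplex are orthogonal. -/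
lemma inner_gradLp_eq_zero_of_disjoint {d : ℕ} {Ω : Set (EuclideanSpace ℝ (Fin d))}
    {K : Geometry.SimplicialComplex ℝ (EuclideanSpace ℝ (Fin d))}
    (hK : IsSimplicialPartition K Ω) {ω τ : Set (Finset (EuclideanSpace ℝ (Fin d)))} {k l : ℕ}
    (hω : ω ⊆ simplices K) (hτ : τ ⊆ simplices K) {u v : sobolevH10 Ω}
    (hu : tsupport (u : EuclideanSpace ℝ (Fin d) → ℝ) ⊆ starSet K ω k)
    (hv : tsupport (v : EuclideanSpace ℝ (Fin d) → ℝ) ⊆ starSet K τ l)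
    (hdisj : Disjoint (starCluster K ω k) (starCluster K τ l)) :
    inner ℝ (gradLp hK.isOpen u) (gradLp hK.isOpen v) = 0 := by
  have hfin : (starCluster K ω k).Finite :=
    hK.finite.subset fun S hS => (starCluster_subset_simplices hω k hS).1
  rw [L2.inner_def]
  refine integral_eq_zero_of_ae ?_
  have hv' : ∀ᵐ x ∂(volume.restrict Ω), ∀ S ∈ starCluster K ω k,
      x ∈ simplexSet S → gradLp hK.isOpen v x = 0 :=
    (ae_ball_iff hfin.countable).2 fun S hS => gradLp_ae_eq_zero_on_simplexSet hK hτ hv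
      (starCluster_subset_simplices hω k hS) (Set.disjoint_left.1 hdisj hS)
  filter_upwards [hv', gradLp_ae_eq_zero_of_notMem_tsupport hK.isOpen u] with x h1 h2
  by_cases hx : x ∈ tsupport (u : EuclideanSpace ℝ (Fin d) → ℝ)
  · obtain ⟨S, hS, hxS⟩ := Set.mem_iUnion₂.1 (hu hx)
    simp [h1 S hS hxS]
  · simp [h2 hx]

/-! ### Decay of the coefficients -/

/-- If `g = ∑ c ξ • v ξ` is orthogonal to the vectors with index in the middle set `M₁` of an
increasing chain `M₀ ⊆ M₁ ⊆ M₂`, and vectors are orthogonal across the gaps of the chain, then the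
coefficients on `M₀` are dominated by those on `M₂` with a contraction factor. -/
lemma sum_sq_coeff_le_of_orthogonal {H ι : Type*} [NormedAddCommGroup H] [InnerProductSpace ℝ H]
    [Fintype ι] [DecidableEq ι] (v : ι → H) {C₁ C₂ : ℝ} (hC₁ : 0 ≤ C₁)
    (hv : ∀ c : ι → ℝ, C₁ * ∑ ξ, c ξ ^ 2 ≤ ‖∑ ξ, c ξ • v ξ‖ ^ 2 ∧
      ‖∑ ξ, c ξ • v ξ‖ ^ 2 ≤ C₂ * ∑ ξ, c ξ ^ 2)
    (c : ι → ℝ) {M₀ M₁ M₂ : Finset ι} (h01 : M₀ ⊆ M₁) (h12 : M₁ ⊆ M₂)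
    (hg : ∀ ξ ∈ M₁, inner ℝ (∑ η, c η • v η) (v ξ) = 0)
    (h0 : ∀ ξ ∈ M₀, ∀ η, η ∉ M₁ → inner ℝ (v η) (v ξ) = 0)
    (h1 : ∀ ξ ∈ M₁, ∀ η, η ∉ M₂ → inner ℝ (v η) (v ξ) = 0) :
    (2 * C₁ + C₂) * ∑ ξ ∈ M₀, c ξ ^ 2 ≤ C₂ * ∑ ξ ∈ M₂, c ξ ^ 2 := by
  -- The Riesz bounds pass to partial sums by setting the coefficients off `s` to zero.
  have riesz : ∀ s : Finset ι, C₁ * ∑ ξ ∈ s, c ξ ^ 2 ≤ ‖∑ ξ ∈ s, c ξ • v ξ‖ ^ 2 ∧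
      ‖∑ ξ ∈ s, c ξ • v ξ‖ ^ 2 ≤ C₂ * ∑ ξ ∈ s, c ξ ^ 2 := fun s => by
    simpa [Finset.sum_ite_mem, ite_smul, ite_pow] using hv fun ξ => if ξ ∈ s then c ξ else 0
  set S : Finset ι → H := fun s => ∑ ξ ∈ s, c ξ • v ξ with hS
  have horth : ∀ s t : Finset ι, (∀ η ∈ s, ∀ ξ ∈ t, inner ℝ (v η) (v ξ) = 0) →
      inner ℝ (S s) (S t) = 0 := fun s t h => by
    simp only [hS, sum_inner, inner_sum]
    exact Finset.sum_eq_zero fun ξ hξ => Finset.sum_eq_zero fun η hη => by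
      simp [inner_smul_left, inner_smul_right, h η hη ξ hξ]
  have e0 : S (M₁ \ M₀) + S M₀ = S M₁ := Finset.sum_sdiff h01
  have e1 : S (M₂ \ M₁) + S M₁ = S M₂ := Finset.sum_sdiff h12
  have e2 : S M₂ᶜ + S M₂ = S Finset.univ := Finset.sum_compl_add_sum M₂ _
  have i1 : inner ℝ (S Finset.univ) (S M₁) = 0 := by
    simp only [hS] at hg ⊢
    rw [inner_sum]
    exact Finset.sum_eq_zero fun ξ hξ => by rw [inner_smul_right, hg ξ hξ, mul_zero]
  have i2 : inner ℝ (S M₂ᶜ) (S M₁) = 0 :=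
    horth _ _ fun η hη ξ hξ => h1 ξ hξ η (Finset.mem_compl.1 hη)
  have i3 : inner ℝ (S (M₂ \ M₁)) (S M₀) = 0 :=
    horth _ _ fun η hη ξ hξ => h0 ξ hξ η (Finset.mem_sdiff.1 hη).2
  have key : ‖S M₁‖ ^ 2 + inner ℝ (S (M₂ \ M₁)) (S (M₁ \ M₀)) = 0 := by
    have h : inner ℝ (S (M₂ \ M₁)) (S M₁) = inner ℝ (S (M₂ \ M₁)) (S (M₁ \ M₀)) := by
      rw [← e0, inner_add_right, i3, add_zero]
    rw [← e2, ← e1, inner_add_left, i2, inner_add_left, h, real_inner_self_eq_norm_sq] at i1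
    linarith
  -- `‖x + y‖² ≥ 0` gives `-2⟨x, y⟩ ≤ ‖x‖² + ‖y‖²`, which suits the additive bounds on the two
  -- disjoint shells.
  have hsq := norm_add_sq_real (S (M₂ \ M₁)) (S (M₁ \ M₀))
  have hnn := sq_nonneg ‖S (M₂ \ M₁) + S (M₁ \ M₀)‖
  have a0 := Finset.sum_sdiff (f := fun ξ => c ξ ^ 2) h01
  have a1 := Finset.sum_sdiff (f := fun ξ => c ξ ^ 2) h12
  have r1 := (riesz M₁).1
  have r2 := (riesz (M₂ \ M₁)).2
  have r3 := (riesz (M₁ \ M₀)).2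
  have r4 : C₁ * ∑ ξ ∈ M₀, c ξ ^ 2 ≤ ‖S M₁‖ ^ 2 :=
    (mul_le_mul_of_nonneg_left (Finset.sum_le_sum_of_subset_of_nonneg h01
      fun _ _ _ => sq_nonneg _) hC₁).trans r1
  simp only [hS] at *
  have : C₂ * (∑ ξ ∈ M₂ \ M₁, c ξ ^ 2 + ∑ ξ ∈ M₁ \ M₀, c ξ ^ 2)
      = C₂ * ∑ ξ ∈ M₂, c ξ ^ 2 - C₂ * ∑ ξ ∈ M₀, c ξ ^ 2 := by
    rw [← a1, ← a0]; ring
  linarith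

/-- The last of `m` steps starts at `j = 4 * m - 3`, so `j + 3 ≤ k` is exactly `4 * m ≤ k`. -/
lemma le_pow_mul_of_le_mul_add_four {a : ℕ → ℝ} {q : ℝ} (hq : 0 ≤ q) {k : ℕ}
    (h : ∀ j, j + 3 ≤ k → a j ≤ q * a (j + 4)) :
    ∀ m, 4 * m ≤ k → a 1 ≤ q ^ m * a (1 + 4 * m)
  | 0, _ => by simp
  | m + 1, hm => by
    refine (le_pow_mul_of_le_mul_add_four hq h m (by omega)).trans ?_
    rw [pow_succ, mul_assoc]
    exact mul_le_mul_of_nonneg_left (h (1 + 4 * m) (by omega)) (pow_nonneg hq m)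

/-- Exponential decay with the explicit rate `C₂ / (2 C₁ + C₂)` per four layers. -/
lemma energyNormOn_sq_le {d n : ℕ} {Ω : Set (EuclideanSpace ℝ (Fin d))}
    {K : Geometry.SimplicialComplex ℝ (EuclideanSpace ℝ (Fin d))}
    (hK : IsSimplicialPartition K Ω) {ι : Type*} [Fintype ι]
    (B : Module.Basis ι ℝ (splineH10 K Ω n)) {C₁ C₂ : ℝ} (hC₁ : 0 < C₁) (hC₂ : 0 < C₂)
    (hloc : IsOneLocal K (fun ξ => (B ξ : EuclideanSpace ℝ (Fin d) → ℝ)))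
    (hR : RieszBounds Ω (fun ξ => (B ξ : EuclideanSpace ℝ (Fin d) → ℝ)) C₁ C₂)
    {ω : Set (Finset (EuclideanSpace ℝ (Fin d)))} (hω : ω ⊆ simplices K)
    {T : Finset (EuclideanSpace ℝ (Fin d))} (hT : T ∈ ω) {k : ℕ}
    {g : EuclideanSpace ℝ (Fin d) → ℝ} (hg : g ∈ splineH10 K Ω n)
    (horth : ∀ w ∈ splineH10 K Ω n, tsupport w ⊆ starSet K ω k → energyInner Ω g w = 0)
    {m : ℕ} (hm : 4 * m ≤ k) :
    energyNormOn Ω (simplexSet T) g ^ 2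
      ≤ C₂ / C₁ * (C₂ / (2 * C₁ + C₂)) ^ m * energyNorm Ω g ^ 2 := by
  classical
  choose τ hτ hsupp using hloc
  let ι₀ : splineH10 K Ω n →ₗ[ℝ] sobolevH10 Ω := Submodule.inclusion inf_le_left
  let b : ι → sobolevH10 Ω := fun ξ => ι₀ (B ξ)
  let v : ι → Lp (EuclideanSpace ℝ (Fin d)) 2 (volume.restrict Ω) :=
    fun ξ => gradLp hK.isOpen (b ξ)
  have hτ' : ∀ ξ, ({τ ξ} : Set (Finset (EuclideanSpace ℝ (Fin d)))) ⊆ simplices K :=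
    fun ξ => Set.singleton_subset_iff.2 (hτ ξ)
  have hv : ∀ c : ι → ℝ, C₁ * ∑ ξ, c ξ ^ 2 ≤ ‖∑ ξ, c ξ • v ξ‖ ^ 2 ∧
      ‖∑ ξ, c ξ • v ξ‖ ^ 2 ≤ C₂ * ∑ ξ, c ξ ^ 2 := fun c => by
    have e : ‖∑ ξ, c ξ • v ξ‖
        = energyNorm Ω (∑ ξ, c ξ • (B ξ : EuclideanSpace ℝ (Fin d) → ℝ)) := by
      have h := norm_gradLp hK.isOpen (∑ ξ, c ξ • b ξ)
      simp only [map_sum, map_smul] at h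
      rw [h]
      congr 1
      simp only [Submodule.coe_sum, Submodule.coe_smul]
      rfl
    rw [e]
    simpa only [sq_abs] using hR c
  let c : ι → ℝ := fun ξ => B.repr ⟨g, hg⟩ ξ
  let g' : sobolevH10 Ω := ι₀ ⟨g, hg⟩
  have hgb : g' = ∑ ξ, c ξ • b ξ := by
    have h := congrArg ι₀ (B.sum_repr ⟨g, hg⟩)
    simpa only [map_sum, map_smul] using h.symm
  have hgv : gradLp hK.isOpen g' = ∑ ξ, c ξ • v ξ := by
    rw [hgb]; simp only [map_sum, map_smul, v]
  let M : ℕ → Finset ι := fun j => Finset.univ.filter fun ξ => τ ξ ∈ starCluster K ω j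
  have hM : Monotone M := fun i j hij ξ hξ => by
    simp only [M, Finset.mem_filter, Finset.mem_univ, true_and] at hξ ⊢
    exact starCluster_mono hω hij hξ
  -- One layer is lost: `star^1(T_ξ)` lies in `star^(j+1)(ω)`, hence in `star^k(ω)`.
  have hgM : ∀ j, j + 1 ≤ k → ∀ ξ ∈ M j, inner ℝ (∑ η, c η • v η) (v ξ) = 0 := by
    intro j hj ξ hξ
    rw [← hgv, inner_gradLp]
    refine horth _ (B ξ).2 ((hsupp ξ).trans (Set.biUnion_subset_biUnion_left fun S hS => ?_))
    obtain ⟨h1, h2⟩ := mem_starCluster_singleton_one.1 hS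
    exact starCluster_mono hω hj ⟨h1, τ ξ, (Finset.mem_filter.1 hξ).2, h2⟩
  -- A simplex common to both stars would lie in `star^(j+1)(ω)` and touch `T_η`, putting `η` in `M
  -- (j + 2)`.
  have hfar : ∀ j, ∀ ξ ∈ M j, ∀ η, η ∉ M (j + 2) → inner ℝ (v η) (v ξ) = 0 := by
    intro j ξ hξ η hη
    refine inner_gradLp_eq_zero_of_disjoint hK (hτ' η) (hτ' ξ) (hsupp η) (hsupp ξ)
      (Set.disjoint_left.2 fun S hSη hSξ => hη ?_)
    obtain ⟨h1, h2⟩ := mem_starCluster_singleton_one.1 hSη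
    obtain ⟨-, h3⟩ := mem_starCluster_singleton_one.1 hSξ
    exact Finset.mem_filter.2 ⟨Finset.mem_univ _, hτ η, S,
      ⟨h1, τ ξ, (Finset.mem_filter.1 hξ).2, h3⟩, by rwa [Set.inter_comm]⟩
  let a : ℕ → ℝ := fun j => ∑ ξ ∈ M j, c ξ ^ 2
  have hpos : 0 < 2 * C₁ + C₂ := by positivity
  -- The chain is `M j ⊆ M (j + 2) ⊆ M (j + 4)`; orthogonality of `g` on the middle set costs `j + 3
  -- ≤ k`.
  have hstep : ∀ j, j + 3 ≤ k → a j ≤ C₂ / (2 * C₁ + C₂) * a (j + 4) := fun j hj => by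
    rw [div_mul_eq_mul_div, le_div_iff₀ hpos, mul_comm]
    exact sum_sq_coeff_le_of_orthogonal v hC₁.le hv c (hM (by omega : j ≤ j + 2))
      (hM (by omega : j + 2 ≤ j + 4)) (hgM (j + 2) hj) (hfar j) (hfar (j + 2))
  have hdecay := le_pow_mul_of_le_mul_add_four (by positivity) hstep m hm
  have hlast : a (1 + 4 * m) ≤ energyNorm Ω g ^ 2 / C₁ := by
    rw [le_div_iff₀ hC₁, mul_comm]
    have h := (hv c).1
    rw [← hgv, norm_gradLp] at h
    exact (mul_le_mul_of_nonneg_left (Finset.sum_le_sum_of_subset_of_nonneg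
      (Finset.subset_univ _) fun _ _ _ => sq_nonneg _) hC₁.le).trans h
  have hfirst : energyNormOn Ω (simplexSet T) g ≤ ‖∑ ξ ∈ M 1, c ξ • v ξ‖ := by
    have hu : gradLp hK.isOpen (∑ ξ ∈ M 1, c ξ • b ξ) = ∑ ξ ∈ M 1, c ξ • v ξ := by
      simp only [map_sum, map_smul, v]
    rw [← hu]
    refine energyNormOn_le_norm hK.isOpen g' _ ?_
    -- If `T` lies in `star^1(T_ξ)`, then `T_ξ` touches `T ∈ ω`, so `ξ ∈ M 1`. The other terms do
    -- not contribute on `T`, which is why the iteration starts at `a 1`.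
    have hout : ∀ᵐ x ∂(volume.restrict Ω), x ∈ simplexSet T →
        (∑ ξ ∈ (M 1)ᶜ, c ξ • v ξ : Lp (EuclideanSpace ℝ (Fin d)) 2 (volume.restrict Ω)) x
          = 0 := by
      refine Finset.sum_induction _ (fun f : Lp (EuclideanSpace ℝ (Fin d)) 2
        (volume.restrict Ω) => ∀ᵐ x ∂(volume.restrict Ω), x ∈ simplexSet T → f x = 0) ?_ ?_ ?_
      · intro f₁ f₂ h₁ h₂
        filter_upwards [h₁, h₂, Lp.coeFn_add f₁ f₂] with x h1 h2 h3 hx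
        rw [h3, Pi.add_apply, h1 hx, h2 hx, add_zero]
      · filter_upwards [Lp.coeFn_zero (EuclideanSpace ℝ (Fin d)) 2 (volume.restrict Ω)]
          with x h _
        rw [h, Pi.zero_apply]
      · intro ξ hξ
        have h := gradLp_ae_eq_zero_on_simplexSet hK (hτ' ξ) (u := b ξ) (hsupp ξ) (hω hT)
          fun hTξ => Finset.mem_compl.1 hξ <| Finset.mem_filter.2 ⟨Finset.mem_univ _, hτ ξ, T,
            hT, by
              rw [Set.inter_comm]
              exact (mem_starCluster_singleton_one.1 hTξ).2⟩
        filter_upwards [h, Lp.coeFn_smul (c ξ) (v ξ)] with x h1 h2 hx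
        rw [h2, Pi.smul_apply, h1 hx, smul_zero]
    rw [hu, hgv, ← Finset.sum_compl_add_sum (M 1)]
    filter_upwards [hout, Lp.coeFn_add (∑ ξ ∈ (M 1)ᶜ, c ξ • v ξ) (∑ ξ ∈ M 1, c ξ • v ξ)]
      with x h1 h2 hx
    rw [h2, Pi.add_apply, h1 hx, zero_add]
  have hupper : ‖∑ ξ ∈ M 1, c ξ • v ξ‖ ^ 2 ≤ C₂ * a 1 := by
    simpa [Finset.sum_ite_mem, ite_smul, ite_pow] using
      (hv fun ξ => if ξ ∈ M 1 then c ξ else 0).2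
  calc energyNormOn Ω (simplexSet T) g ^ 2 ≤ ‖∑ ξ ∈ M 1, c ξ • v ξ‖ ^ 2 :=
        pow_le_pow_left₀ (Real.sqrt_nonneg _) hfirst 2
    _ ≤ C₂ * ((C₂ / (2 * C₁ + C₂)) ^ m * (energyNorm Ω g ^ 2 / C₁)) :=
        hupper.trans (mul_le_mul_of_nonneg_left (hdecay.trans
          (mul_le_mul_of_nonneg_left hlast (by positivity))) hC₂.le)
    _ = _ := by ring

/-! ### Constants depending only on the ratio -/

theorem mainTheorem4 :
    ∀ ρ : ℝ, ∃ σ C : ℝ, 0 < σ ∧ σ < 1 ∧ 0 < C ∧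
      ∀ (d : ℕ), 2 ≤ d →
      ∀ (Ω : Set (EuclideanSpace ℝ (Fin d)))
        (K : Geometry.SimplicialComplex ℝ (EuclideanSpace ℝ (Fin d))),
        IsSimplicialPartition K Ω →
      ∀ (n : ℕ), 1 ≤ n →
      ∀ (ι : Type*) [Fintype ι] (B : Module.Basis ι ℝ (splineH10 K Ω n)) (C₁ C₂ : ℝ),
        0 < C₁ → 0 < C₂ → C₂ / C₁ = ρ →
        IsOneLocal K (fun ξ => (B ξ : EuclideanSpace ℝ (Fin d) → ℝ)) →
        RieszBounds Ω (fun ξ => (B ξ : EuclideanSpace ℝ (Fin d) → ℝ)) C₁ C₂ →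
      ∀ (ω : Set (Finset (EuclideanSpace ℝ (Fin d)))), ω ⊆ simplices K →
      ∀ T ∈ ω, ∀ k : ℕ, 1 ≤ k →
      ∀ g ∈ splineH10 K Ω n,
        (∀ w ∈ splineH10 K Ω n, tsupport w ⊆ starSet K ω k → energyInner Ω g w = 0) →
        energyNormOn Ω (simplexSet T) g ≤ C * σ ^ k * energyNorm Ω g := by
  intro ρ
  rcases le_or_gt ρ 0 with hρ | hρ
  · refine ⟨1 / 2, 1, by norm_num, by norm_num, one_pos, ?_⟩
    intro d _ Ω K _ n _ ι _ B C₁ C₂ h1 h2 h12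
    exact absurd (h12 ▸ div_pos h2 h1) hρ.not_gt
  have hq : 0 < ρ / (2 + ρ) := by positivity
  have hq1 : ρ / (2 + ρ) < 1 := (div_lt_one (by positivity)).2 (by linarith)
  -- Eighth root: each contraction takes four layers and acts on squared norms.
  obtain ⟨σ, hσ, hσ1, hσ8⟩ : ∃ σ : ℝ, 0 < σ ∧ σ < 1 ∧ σ ^ 8 = ρ / (2 + ρ) := by
    refine ⟨(ρ / (2 + ρ)) ^ ((8 : ℕ) : ℝ)⁻¹, Real.rpow_pos_of_pos hq _,
      Real.rpow_lt_one hq.le hq1 (by norm_num), Real.rpow_inv_natCast_pow hq.le (by norm_num)⟩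
  refine ⟨σ, Real.sqrt (2 + ρ), hσ, hσ1, Real.sqrt_pos.2 (by positivity), ?_⟩
  intro d _ Ω K hK n _ ι _ B C₁ C₂ hC₁ hC₂ h12 hloc hR ω hω T hT k _ g hg horth
  have h := energyNormOn_sq_le hK B hC₁ hC₂ hloc hR hω hT hg horth (Nat.mul_div_le k 4)
  have hrate : C₂ / (2 * C₁ + C₂) = ρ / (2 + ρ) := by
    rw [← h12]; field_simp
  rw [hrate, h12] at h
  -- Rewriting the prefactor `ρ` as `(2 + ρ) * (ρ / (2 + ρ))` yields one more power of the rate.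
  -- This absorbs the rounding in `k / 4`, since `8 * (k / 4 + 1) ≥ 2 * k`, and explains `C = √(2 +
  -- ρ)`.
  have hpow : ρ * (ρ / (2 + ρ)) ^ (k / 4) ≤ (2 + ρ) * (σ ^ k) ^ 2 := by
    have e : ρ * (ρ / (2 + ρ)) ^ (k / 4) = (2 + ρ) * (ρ / (2 + ρ)) ^ (k / 4 + 1) := by
      rw [pow_succ]; field_simp
    rw [e, ← hσ8, ← pow_mul, ← pow_mul]
    exact mul_le_mul_of_nonneg_left
      (pow_le_pow_of_le_one hσ.le hσ1.le (by omega)) (by positivity)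
  have hnonneg : 0 ≤ energyNorm Ω g := Real.sqrt_nonneg _
  refine le_of_sq_le_sq ?_ (by positivity)
  rw [mul_pow, mul_pow, Real.sq_sqrt (by positivity)]
  exact h.trans (mul_le_mul_of_nonneg_right hpow (sq_nonneg _))
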